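/- **Theorem.** Let $W=(W(t))_{t\ge 0}$ be a standard Brownian motion on a probability space, and let $\rho,\sigma,\tau,x_0>0$ be constants. Consider the random multiplicative process $$x_{i+1}=a_i x_i,\qquad a_i=1+\rho\, e^{\sigma W(t_i)-\frac12\sigma^2 t_i},\qquad t_i=i\tau ,\qquad i\ge 0,$$ started from $x_0$. Fix $\rho>0$ and $\beta>0$, and let $n\to\infty$ with $\sigma=\sigma_n>0$ and $\tau=\tau_n>0$ depending on $n$ in such a way that $$\tfrac12\sigma_n^2\tau_n n^2=\beta\quad\text{for all } n\ge 1 .$$ Then for every positive integer $q$ the moments $\mathbb{E}[x_n^q]$ are finite and the limit $$\lambda(\rho,\beta;q):=\lim_{n\to\infty}\frac1n\log\mathbb{E}[x_n^q]$$ exists in $\mathbb{R}$; it depends only on $\rho,\beta,q$ (not on $x_0$ or on the choice of the sequences $\sigma_n,\tau_n$), and $$\lambda(\rho,\beta;q)=\sup_{g\in\mathcal G_q}\left\{g(1)\log\rho+\beta\int_0^1 (g(1)-g(x))^2\,dx-q\int_0^1 I\!\left(\frac{g'(x)}{q}\right)dx\right\},$$ where $I(x)=x\log x+(1-x)\log(1-x)$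 for $x\in[0,1]$ (with $0\log 0=0$) and $$\mathcal G_q=\left\{g:[0,1]\to[0,q]\ :\ g(0)=0,\ g\text{ is absolutely continuous and } 0\le g'\le q \text{ almost everywhere}\right\}.$$ Moreover, $$\lambda(\rho,\beta;q)=q\,\lambda(\rho,q\beta;1).$$ -/

import Mathlib

open MeasureTheory ProbabilityTheory Filter Topology
open scoped NNReal

namespace LyapunovRMP

/-- The multiplier `a_i = 1 + ρ exp (σ W(t_i) - σ² t_i / 2)` with `t_i = i τ`. -/
noncomputable def multiplier {Ω : Type*} (W : ℝ≥0 → Ω → ℝ) (ρ σ : ℝ) (τ : ℝ≥0)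
    (i : ℕ) (ω : Ω) : ℝ :=
  1 + ρ * Real.exp (σ * W (i * τ) ω - σ ^ 2 * (i * τ) / 2)

/-- The random multiplicative process `x_{i+1} = a_i x_i` started from `x_0`. -/
noncomputable def process {Ω : Type*} (W : ℝ≥0 → Ω → ℝ) (x₀ ρ σ : ℝ) (τ : ℝ≥0) :
    ℕ → Ω → ℝ
  | 0, _ => x₀
  | i + 1, ω => multiplier W ρ σ τ i ω * process W x₀ ρ σ τ i ω

/-- `I(x) = x log x + (1 - x) log (1 - x)`, with the convention `0 log 0 = 0`. -/
noncomputable def entropy (x : ℝ) : ℝ :=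
  x * Real.log x + (1 - x) * Real.log (1 - x)

/-- The class `𝒢_q` of absolutely continuous `g : [0,1] → [0,q]` with `g(0) = 0` and
`0 ≤ g' ≤ q` almost everywhere. Only the restriction of `g` to `[0,1]` matters. -/
def admissible (q : ℕ) : Set (ℝ → ℝ) :=
  {g | Set.MapsTo g (Set.Icc 0 1) (Set.Icc 0 (q : ℝ)) ∧ g 0 = 0 ∧
    AbsolutelyContinuousOnInterval g 0 1 ∧
    ∀ᵐ x ∂(volume.restrict (Set.Ioo (0 : ℝ) 1)), 0 ≤ deriv g x ∧ deriv g x ≤ q}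

/-- The functional `g(1) log ρ + β ∫₀¹ (g(1) - g(x))² dx - q ∫₀¹ I(g'(x) / q) dx`. -/
noncomputable def functional (ρ β : ℝ) (q : ℕ) (g : ℝ → ℝ) : ℝ :=
  g 1 * Real.log ρ + β * (∫ x in (0 : ℝ)..1, (g 1 - g x) ^ 2)
    - q * ∫ x in (0 : ℝ)..1, entropy (deriv g x / q)

end LyapunovRMP

namespace LyapunovRMP

/-! The moment is a partition function. Expanding the `q`-th power of the product gives a sum over
subsets `S` of an `n × q` box. The Gaussian expectation of each term is explicit: its exponent is
quadratic in the fibre counts of `S`, a mean-field interaction of strength `β / n²`, minus a drift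
that is `O(1)` in total. The exponential rate is therefore an energy-entropy optimum, first over
discrete profiles `p`, then over functions `g` with `g' = q p`.

Neither bound counts subsets. Below, Gibbs' inequality `exp (p y - entropy p) ≤ 1 + exp y` is
inserted into every factor and the result is integrated exactly
(`exp_discreteFunctional_le_integral`). Above, each squared tail `T²` equals `2aT - a² + (T - a)²`.
For fixed `a` the sum over `S` factorizes, and the equality case of Gibbs bounds it by the discrete
optimum (`sum_exp_linearized_le`). Taking `a` constant on about `√n` blocks leaves `exp (O(√n log
n))` choices of `a` and an `O(1)` error in the exponent (`integral_prod_multiplier_pow_le`).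

The discrete and continuous optima agree up to `O(1)` after multiplication by `n`. Cell averages of
`g'` lose no entropy by Jensen, polygons turn profiles into admissible functions, and the quadratic
terms are Riemann sums of a monotone function. The relation in `q` is the bijection `g ↦ q g`. -/

/-! ### Quadratic form and Gaussian exponential moments. -/

/-- The sum of `c i` over the indices `m ≤ i < n`. -/
noncomputable def tailSum (n : ℕ) (c : ℕ → ℝ) (m : ℕ) : ℝ :=
  ∑ i ∈ Finset.range n, if m ≤ i then c i else 0

/-- The quadratic form `∑_{i,j<n} c_i c_j min(i,j)`, written as a sum of squares of tails. -/
noncomputable def energy (n : ℕ) (c : ℕ → ℝ) : ℝ :=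
  ∑ l ∈ Finset.range n, tailSum n c (l + 1) ^ 2

/-- `min i j` counts the `l` with `l + 1 ≤ i` and `l + 1 ≤ j`. This identifies `energy` with the
Brownian covariance form at unit time step. -/
theorem energy_eq_sum_min (n : ℕ) (c : ℕ → ℝ) :
    energy n c = ∑ i ∈ Finset.range n, ∑ j ∈ Finset.range n, c i * c j * min (i : ℝ) j := by
  have hmin : ∀ i ∈ Finset.range n, ∀ j ∈ Finset.range n,
      ∑ l ∈ Finset.range n, (if l + 1 ≤ i then c i else 0) * (if l + 1 ≤ j then c j else 0)
        = c i * c j * min (i : ℝ) j := by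
    intro i hi j hj
    have h1 : ∀ l ∈ Finset.range n,
        (if l + 1 ≤ i then c i else 0) * (if l + 1 ≤ j then c j else 0)
          = if l ∈ Finset.range (min i j) then c i * c j else 0 := by
      intro l _
      simp only [Finset.mem_range, lt_min_iff, Nat.succ_le_iff]
      split_ifs <;> simp_all
    have h2 : Finset.range n ∩ Finset.range (min i j) = Finset.range (min i j) := by
      ext l
      simp only [Finset.mem_inter, Finset.mem_range] at *
      omega
    rw [Finset.sum_congr rfl h1, Finset.sum_ite_mem, h2, Finset.sum_const, Finset.card_range,
      nsmul_eq_mul, Nat.cast_min, mul_comm]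
  simp_rw [energy, tailSum, sq, Finset.sum_mul_sum]
  rw [Finset.sum_comm]
  refine Finset.sum_congr rfl fun i hi => ?_
  rw [Finset.sum_comm]
  exact Finset.sum_congr rfl fun j hj => hmin i hi j hj

/-- The exponent `σ W(t_i) - σ² t_i / 2` of the multiplier, with `t_i = i τ`. -/
noncomputable def logNoise {Ω : Type*} (W : ℝ≥0 → Ω → ℝ) (σ : ℝ) (τ : ℝ≥0) (i : ℕ) (ω : Ω) : ℝ :=
  σ * W (i * τ) ω - σ ^ 2 * (i * τ) / 2

theorem multiplier_eq {Ω : Type*} (W : ℝ≥0 → Ω → ℝ) (ρ σ : ℝ) (τ : ℝ≥0) (i : ℕ) (ω : Ω) :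
    multiplier W ρ σ τ i ω = 1 + ρ * Real.exp (logNoise W σ τ i ω) := rfl

theorem process_eq_prod {Ω : Type*} (W : ℝ≥0 → Ω → ℝ) (x₀ ρ σ : ℝ) (τ : ℝ≥0) (n : ℕ) (ω : Ω) :
    process W x₀ ρ σ τ n ω = x₀ * ∏ i ∈ Finset.range n, multiplier W ρ σ τ i ω := by
  induction n with
  | zero => simp [process]
  | succ n ih => rw [process, ih, Finset.prod_range_succ]; ring

theorem map_sum_brownian {Ω : Type*} [MeasurableSpace Ω] {P : Measure Ω} {W : ℝ≥0 → Ω → ℝ}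
    (hW : IsPreBrownianReal W P) (τ : ℝ≥0) (n : ℕ) (c : ℕ → ℝ) :
    P.map (fun ω => ∑ i ∈ Finset.range n, c i * W (i * τ) ω)
      = gaussianReal 0 (τ * energy n c).toNNReal := by
  have hG : IsGaussianProcess (fun (i : ℕ) ω => c i • W (i * τ) ω) P :=
    (hW.isGaussianProcess.comp_right fun i : ℕ => (i : ℝ≥0) * τ).smul c
  have hsum : HasGaussianLaw (fun ω => ∑ i ∈ Finset.range n, c i * W (i * τ) ω) P :=
    hG.hasGaussianLaw_fun_sum
  have := hW.isGaussianProcess.isProbabilityMeasure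
  have hmem : ∀ i : ℕ, MemLp (fun ω => c i * W (i * τ) ω) 2 P := fun i =>
    (hG.hasGaussianLaw_eval i).memLp_two
  rw [hsum.map_eq_gaussianReal]
  congr 2
  · rw [integral_finsetSum _ fun i _ => (hmem i).integrable (by norm_num)]
    refine Finset.sum_eq_zero fun i _ => ?_
    rw [integral_const_mul, hW.integral_eval, mul_zero]
  · rw [← covariance_self hsum.aemeasurable,
      covariance_fun_sum_fun_sum' (fun i _ => hmem i) (fun i _ => hmem i), energy_eq_sum_min,
      Finset.mul_sum]
    refine Finset.sum_congr rfl fun i _ => ?_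
    rw [Finset.mul_sum]
    refine Finset.sum_congr rfl fun j _ => ?_
    rw [covariance_const_mul_left, covariance_const_mul_right, hW.covariance_fun_eval,
      ← min_mul_of_nonneg _ _ (zero_le : 0 ≤ τ)]
    push_cast
    ring

theorem energy_nonneg (n : ℕ) (c : ℕ → ℝ) : 0 ≤ energy n c :=
  Finset.sum_nonneg fun _ _ => sq_nonneg _

theorem sum_mul_logNoise {Ω : Type*} (W : ℝ≥0 → Ω → ℝ) (σ : ℝ) (τ : ℝ≥0) (n : ℕ) (c : ℕ → ℝ)
    (ω : Ω) :
    ∑ i ∈ Finset.range n, c i * logNoise W σ τ i ω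
      = σ * (∑ i ∈ Finset.range n, c i * W (i * τ) ω)
        - σ ^ 2 * τ / 2 * ∑ i ∈ Finset.range n, c i * i := by
  simp_rw [logNoise, Finset.mul_sum, ← Finset.sum_sub_distrib]
  exact Finset.sum_congr rfl fun i _ => by ring

theorem integrable_exp_sum_logNoise {Ω : Type*} [MeasurableSpace Ω] {P : Measure Ω}
    {W : ℝ≥0 → Ω → ℝ} (hW : IsPreBrownianReal W P) (σ : ℝ) (τ : ℝ≥0) (n : ℕ) (c : ℕ → ℝ) :
    Integrable (fun ω => Real.exp (∑ i ∈ Finset.range n, c i * logNoise W σ τ i ω)) P := by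
  have hm : AEMeasurable (fun ω => ∑ i ∈ Finset.range n, c i * W (i * τ) ω) P :=
    Finset.aemeasurable_fun_sum _ fun i _ => (hW.aemeasurable _).const_mul _
  have h := integrable_exp_mul_gaussianReal (μ := 0) (v := (τ * energy n c).toNNReal) σ
  rw [← map_sum_brownian hW τ n c] at h
  simp_rw [sum_mul_logNoise, Real.exp_sub]
  exact (h.comp_aemeasurable hm).div_const _

theorem integral_exp_sum_logNoise {Ω : Type*} [MeasurableSpace Ω] {P : Measure Ω}
    {W : ℝ≥0 → Ω → ℝ} (hW : IsPreBrownianReal W P) (σ : ℝ) (τ : ℝ≥0) (n : ℕ) (c : ℕ → ℝ) :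
    ∫ ω, Real.exp (∑ i ∈ Finset.range n, c i * logNoise W σ τ i ω) ∂P
      = Real.exp (σ ^ 2 * τ / 2 * (energy n c - ∑ i ∈ Finset.range n, c i * i)) := by
  have h := mgf_gaussianReal (map_sum_brownian hW τ n c) σ
  rw [mgf, Real.coe_toNNReal _ (mul_nonneg τ.coe_nonneg (energy_nonneg n c))] at h
  simp_rw [sum_mul_logNoise, Real.exp_sub, integral_div, h, ← Real.exp_sub]
  congr 1
  ring

/-! ### Entropy duality and the discrete functional. -/

/-- Jensen for `exp` at the points `y - log p` and `-log (1 - p)` with weights `p` and `1 - p`. -/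
theorem exp_mul_sub_entropy_le {p : ℝ} (hp : p ∈ Set.Icc (0 : ℝ) 1) (y : ℝ) :
    Real.exp (p * y - entropy p) ≤ 1 + Real.exp y := by
  rcases hp.1.eq_or_lt with rfl | h0
  · simp [entropy, Real.exp_nonneg]
  rcases hp.2.eq_or_lt with rfl | h1
  · simp [entropy]
  have h1' : 0 < 1 - p := sub_pos.2 h1
  have h := convexOn_exp.2 (Set.mem_univ (y - Real.log p)) (Set.mem_univ (-Real.log (1 - p)))
    h0.le h1'.le (by ring)
  simp only [smul_eq_mul, Real.exp_sub, Real.exp_neg, Real.exp_log h0, Real.exp_log h1'] at h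
  have e : p * y - entropy p = p * (y - Real.log p) + (1 - p) * -Real.log (1 - p) := by
    rw [entropy]; ring
  rw [e]
  refine h.trans (le_of_eq ?_)
  field_simp
  ring

/-- Equality case of the preceding bound, attained at the logistic weight. -/
theorem log_one_add_exp_eq (y : ℝ) :
    Real.exp y / (1 + Real.exp y) ∈ Set.Icc (0 : ℝ) 1 ∧
    1 + Real.exp y = Real.exp (Real.exp y / (1 + Real.exp y) * y
      - entropy (Real.exp y / (1 + Real.exp y))) := by
  have hy := Real.exp_pos y
  have hpos : 0 < 1 + Real.exp y := by positivity
  refine ⟨⟨by positivity, (div_le_one hpos).2 (by linarith)⟩, ?_⟩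
  have e1 : 1 - Real.exp y / (1 + Real.exp y) = 1 / (1 + Real.exp y) := by
    field_simp
    ring
  have e2 : Real.exp y / (1 + Real.exp y) * y - entropy (Real.exp y / (1 + Real.exp y))
      = Real.log (1 + Real.exp y) := by
    rw [entropy, e1, Real.log_div hy.ne' hpos.ne', Real.log_div one_ne_zero hpos.ne', Real.log_exp,
      Real.log_one]
    field_simp
    ring
  rw [e2, Real.exp_log hpos]

/-- The discretization of `n` times the variational functional, evaluated at the profile `p` of
success probabilities. -/
noncomputable def discreteFunctional (ρ b : ℝ) (q n : ℕ) (p : ℕ → ℝ) : ℝ :=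
  q * ∑ i ∈ Finset.range n, (p i * Real.log ρ - entropy (p i)) + b * q ^ 2 * energy n p

theorem tailSum_const_mul (n : ℕ) (a : ℝ) (c : ℕ → ℝ) (m : ℕ) :
    tailSum n (fun i => a * c i) m = a * tailSum n c m := by
  simp_rw [tailSum, Finset.mul_sum, mul_ite, mul_zero]

theorem energy_const_mul (n : ℕ) (a : ℝ) (c : ℕ → ℝ) :
    energy n (fun i => a * c i) = a ^ 2 * energy n c := by
  simp_rw [energy, tailSum_const_mul, mul_pow, Finset.mul_sum]

/-! ### Subset expansion of the moment. -/

/-- The finite set of pairs `(i, r)` with `i < n` and `r < q`. -/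
abbrev box (n q : ℕ) : Finset (ℕ × ℕ) := Finset.range n ×ˢ Finset.range q

/-- The number of elements of `S` with first coordinate `i`. -/
noncomputable def fiberCard (S : Finset (ℕ × ℕ)) (i : ℕ) : ℕ := (S.filter fun x => x.1 = i).card

theorem sum_fst_eq {n q : ℕ} {S : Finset (ℕ × ℕ)} (hS : S ⊆ box n q) (f : ℕ → ℝ) :
    ∑ x ∈ S, f x.1 = ∑ i ∈ Finset.range n, fiberCard S i * f i := by
  rw [← Finset.sum_fiberwise_of_maps_to' (t := Finset.range n) (g := Prod.fst)
    fun x hx => (Finset.mem_product.1 (hS hx)).1]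
  simp [fiberCard]

theorem prod_one_add_exp_pow (n q : ℕ) (h : ℕ → ℝ) :
    (∏ i ∈ Finset.range n, (1 + Real.exp (h i))) ^ q
      = ∑ S ∈ (box n q).powerset,
          Real.exp (∑ i ∈ Finset.range n, fiberCard S i * h i) := by
  have : (∏ i ∈ Finset.range n, (1 + Real.exp (h i))) ^ q
      = ∏ x ∈ box n q, (1 + Real.exp (h x.1)) := by
    rw [Finset.prod_product, ← Finset.prod_pow]
    simp
  rw [this, Finset.prod_one_add]
  refine Finset.sum_congr rfl fun S hS => ?_
  rw [← Real.exp_sum, sum_fst_eq (Finset.mem_powerset.1 hS) h]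

theorem prod_multiplier_pow_eq {Ω : Type*} (W : ℝ≥0 → Ω → ℝ) {ρ : ℝ} (hρ : 0 < ρ) (σ : ℝ)
    (τ : ℝ≥0) (n q : ℕ) (ω : Ω) :
    (∏ i ∈ Finset.range n, multiplier W ρ σ τ i ω) ^ q
      = ∑ S ∈ (box n q).powerset,
          Real.exp (∑ i ∈ Finset.range n, fiberCard S i * Real.log ρ) *
            Real.exp (∑ i ∈ Finset.range n, fiberCard S i * logNoise W σ τ i ω) := by
  have : ∀ i, multiplier W ρ σ τ i ω = 1 + Real.exp (Real.log ρ + logNoise W σ τ i ω) := by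
    intro i
    rw [multiplier_eq, Real.exp_add, Real.exp_log hρ]
  simp_rw [this, prod_one_add_exp_pow, mul_add, Finset.sum_add_distrib, Real.exp_add]

theorem integrable_prod_multiplier_pow {Ω : Type*} [MeasurableSpace Ω] {P : Measure Ω}
    {W : ℝ≥0 → Ω → ℝ} (hW : IsPreBrownianReal W P) {ρ : ℝ} (hρ : 0 < ρ) (σ : ℝ) (τ : ℝ≥0)
    (n q : ℕ) :
    Integrable (fun ω => (∏ i ∈ Finset.range n, multiplier W ρ σ τ i ω) ^ q) P := by
  simp_rw [prod_multiplier_pow_eq W hρ]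
  exact integrable_finsetSum _ fun S _ => (integrable_exp_sum_logNoise hW σ τ n _).const_mul _

theorem integral_prod_multiplier_pow {Ω : Type*} [MeasurableSpace Ω] {P : Measure Ω}
    {W : ℝ≥0 → Ω → ℝ} (hW : IsPreBrownianReal W P) {ρ : ℝ} (hρ : 0 < ρ) (σ : ℝ) (τ : ℝ≥0)
    (n q : ℕ) :
    ∫ ω, (∏ i ∈ Finset.range n, multiplier W ρ σ τ i ω) ^ q ∂P
      = ∑ S ∈ (box n q).powerset,
          Real.exp (∑ i ∈ Finset.range n, fiberCard S i * Real.log ρ) *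
            Real.exp (σ ^ 2 * τ / 2 * (energy n (fun i => fiberCard S i)
              - ∑ i ∈ Finset.range n, (fiberCard S i : ℝ) * i)) := by
  simp_rw [prod_multiplier_pow_eq W hρ]
  rw [integral_finsetSum _ fun S _ => (integrable_exp_sum_logNoise hW σ τ n _).const_mul _]
  simp_rw [integral_const_mul, integral_exp_sum_logNoise hW]

/-! ### Lower bound for the moment. -/

/-- Gibbs' inequality with a deterministic `p i` in each factor leaves one log-linear Gaussian
integrand. The subtracted term pays for the drift `∑ q p_i i ≤ q n²`. -/
theorem exp_discreteFunctional_le_integral {Ω : Type*} [MeasurableSpace Ω] {P : Measure Ω}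
    {W : ℝ≥0 → Ω → ℝ} (hW : IsPreBrownianReal W P) {ρ : ℝ} (hρ : 0 < ρ) (σ : ℝ) (τ : ℝ≥0)
    (n q : ℕ) {p : ℕ → ℝ} (hp : ∀ i, p i ∈ Set.Icc (0 : ℝ) 1) :
    Real.exp (discreteFunctional ρ (σ ^ 2 * τ / 2) q n p - σ ^ 2 * τ / 2 * (q * n ^ 2))
      ≤ ∫ ω, (∏ i ∈ Finset.range n, multiplier W ρ σ τ i ω) ^ q ∂P := by
  have hb : 0 ≤ σ ^ 2 * τ / 2 := by positivity
  have hsum : ∑ i ∈ Finset.range n, (q * p i) * (i : ℝ) ≤ q * n ^ 2 := by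
    calc ∑ i ∈ Finset.range n, (q * p i) * (i : ℝ)
        ≤ ∑ i ∈ Finset.range n, (q : ℝ) * n := by
          refine Finset.sum_le_sum fun i hi => ?_
          have hi' : (i : ℝ) ≤ n := by exact_mod_cast (Finset.mem_range.1 hi).le
          exact mul_le_mul (mul_le_of_le_one_right (by positivity) (hp i).2) hi' (by positivity)
            (by positivity)
      _ = q * n ^ 2 := by simp; ring
  calc Real.exp (discreteFunctional ρ (σ ^ 2 * τ / 2) q n p - σ ^ 2 * τ / 2 * (q * n ^ 2))
      ≤ Real.exp (q * ∑ i ∈ Finset.range n, (p i * Real.log ρ - entropy (p i))) *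
          Real.exp (σ ^ 2 * τ / 2 * (energy n (fun i => q * p i)
            - ∑ i ∈ Finset.range n, (q * p i) * (i : ℝ))) := by
        rw [← Real.exp_add, energy_const_mul, discreteFunctional]
        refine Real.exp_le_exp.2 ?_
        have := mul_le_mul_of_nonneg_left hsum hb
        linarith
    _ = ∫ ω, Real.exp (q * ∑ i ∈ Finset.range n, (p i * Real.log ρ - entropy (p i))) *
          Real.exp (∑ i ∈ Finset.range n, (q * p i) * logNoise W σ τ i ω) ∂P := by
        rw [integral_const_mul, integral_exp_sum_logNoise hW]
    _ ≤ _ := by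
        refine integral_mono ((integrable_exp_sum_logNoise hW σ τ n _).const_mul _)
          (integrable_prod_multiplier_pow hW hρ σ τ n q) fun ω => ?_
        have e : (q : ℝ) * ∑ i ∈ Finset.range n, (p i * Real.log ρ - entropy (p i))
            + ∑ i ∈ Finset.range n, (q * p i) * logNoise W σ τ i ω
            = q * ∑ i ∈ Finset.range n,
                (p i * (Real.log ρ + logNoise W σ τ i ω) - entropy (p i)) := by
          simp_rw [Finset.mul_sum, ← Finset.sum_add_distrib]
          exact Finset.sum_congr rfl fun i _ => by ring
        simp only [← Real.exp_add, e]
        rw [Real.exp_nat_mul, Real.exp_sum]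
        refine pow_le_pow_left₀ (Finset.prod_nonneg fun _ _ => (Real.exp_pos _).le)
          (Finset.prod_le_prod (fun _ _ => (Real.exp_pos _).le) fun i _ => ?_) q
        rw [multiplier_eq]
        refine (exp_mul_sub_entropy_le (hp i) _).trans_eq ?_
        rw [Real.exp_add, Real.exp_log hρ]

/-! ### Upper bound by linearization over blocks. -/

theorem sum_mul_tailSum (n : ℕ) (a c : ℕ → ℝ) :
    ∑ l ∈ Finset.range n, a l * tailSum n c (l + 1)
      = ∑ i ∈ Finset.range n, c i * ∑ l ∈ Finset.range n, if l + 1 ≤ i then a l else 0 := by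
  simp_rw [tailSum, Finset.mul_sum]
  rw [Finset.sum_comm]
  refine Finset.sum_congr rfl fun i _ => Finset.sum_congr rfl fun l _ => ?_
  split_ifs <;> ring

/-- Replacing the square of each tail by a tangent line decouples the partition function, and
completing the square bounds it by the discrete functional. -/
theorem sum_exp_linearized_le {ρ b : ℝ} (hb : 0 ≤ b) (n q : ℕ) {M : ℝ}
    (hM : ∀ p : ℕ → ℝ, (∀ i, p i ∈ Set.Icc (0 : ℝ) 1) → discreteFunctional ρ b q n p ≤ M)
    (a : ℕ → ℝ) :
    ∑ S ∈ (box n q).powerset,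
      Real.exp (∑ i ∈ Finset.range n, fiberCard S i * Real.log ρ +
        b * ∑ l ∈ Finset.range n,
          (2 * a l * tailSum n (fun i => fiberCard S i) (l + 1) - a l ^ 2)) ≤ Real.exp M := by
  -- The effective field at site `i`: exchanging summations makes the linearized exponent `∑ c_i h_i
  -- - b ∑ a_l²`, so sites decouple. The logistic `p` below turns the factorized sum into an exact
  -- exponential.
  let h : ℕ → ℝ := fun i =>
    Real.log ρ + 2 * b * ∑ l ∈ Finset.range n, if l + 1 ≤ i then a l else 0
  let p : ℕ → ℝ := fun i => Real.exp (h i) / (1 + Real.exp (h i))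
  have hp : ∀ i, p i ∈ Set.Icc (0 : ℝ) 1 := fun i => (log_one_add_exp_eq (h i)).1
  have hlin : ∀ c : ℕ → ℝ, ∑ i ∈ Finset.range n, c i * Real.log ρ +
        b * ∑ l ∈ Finset.range n, (2 * a l * tailSum n c (l + 1) - a l ^ 2)
      = ∑ i ∈ Finset.range n, c i * h i + -b * ∑ l ∈ Finset.range n, a l ^ 2 := by
    intro c
    have := sum_mul_tailSum n a c
    simp only [h, mul_add, Finset.sum_add_distrib, Finset.sum_sub_distrib]
    simp only [mul_assoc, ← Finset.mul_sum, mul_left_comm (c _)]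
    rw [this]
    ring
  have hprod : (∏ i ∈ Finset.range n, (1 + Real.exp (h i))) ^ q
      = Real.exp (q * ∑ i ∈ Finset.range n, (p i * h i - entropy (p i))) := by
    rw [Real.exp_nat_mul, Real.exp_sum]
    exact congrArg (· ^ q) (Finset.prod_congr rfl fun i _ => (log_one_add_exp_eq (h i)).2)
  simp_rw [hlin, Real.exp_add]
  rw [← Finset.sum_mul, ← prod_one_add_exp_pow, hprod, ← Real.exp_add]
  refine Real.exp_le_exp.2 (le_trans ?_ (hM p hp))
  have hlp := hlin fun i => q * p i
  -- The tangent line lies below the square, so the linearized energy at `q p` is at most the true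
  -- one, whatever `a` is.
  have hsq : ∑ l ∈ Finset.range n,
      (2 * a l * tailSum n (fun i => q * p i) (l + 1) - a l ^ 2) ≤ q ^ 2 * energy n p := by
    rw [← energy_const_mul, energy]
    refine Finset.sum_le_sum fun l _ => ?_
    linarith [sq_nonneg (tailSum n (fun i => q * p i) (l + 1) - a l)]
  have hsq' := mul_le_mul_of_nonneg_left hsq hb
  rw [discreteFunctional]
  simp only [Finset.sum_sub_distrib, mul_sub, mul_assoc, ← Finset.mul_sum] at hlp hsq' ⊢
  linarith

/-- The number of elements of `S` with first coordinate at least `m`. -/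
def tailCard (S : Finset (ℕ × ℕ)) (m : ℕ) : ℕ := (S.filter fun x => m ≤ x.1).card

theorem tailSum_fiberCard {n q : ℕ} {S : Finset (ℕ × ℕ)} (hS : S ⊆ box n q) (m : ℕ) :
    tailSum n (fun i => fiberCard S i) m = tailCard S m := by
  have h := sum_fst_eq hS fun i => if m ≤ i then 1 else 0
  simp only [mul_ite, mul_one, mul_zero] at h
  rw [tailSum, ← h, tailCard, Finset.card_filter]
  push_cast
  rfl

theorem tailCard_le {n q : ℕ} {S : Finset (ℕ × ℕ)} (hS : S ⊆ box n q) (m : ℕ) :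
    tailCard S m ≤ n * q := by
  refine (Finset.card_le_card ((Finset.filter_subset _ _).trans hS)).trans_eq ?_
  simp

theorem tailCard_anti (S : Finset (ℕ × ℕ)) {m m' : ℕ} (h : m ≤ m') :
    tailCard S m' ≤ tailCard S m :=
  Finset.card_le_card (Finset.monotone_filter_right S fun _ _ hx => h.trans hx)

theorem tailCard_le_add {n q : ℕ} {S : Finset (ℕ × ℕ)} (hS : S ⊆ box n q) (m m' : ℕ) :
    tailCard S m ≤ tailCard S m' + (m' - m) * q := by
  have hsub : (S.filter fun x => m ≤ x.1)
      ⊆ (S.filter fun x => m' ≤ x.1) ∪ Finset.Ico m m' ×ˢ Finset.range q := by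
    intro x hx
    have h1 := Finset.mem_filter.1 hx
    have h2 := (Finset.mem_product.1 (hS h1.1)).2
    simp only [Finset.mem_union, Finset.mem_filter, Finset.mem_product, Finset.mem_Ico]
    rcases le_or_gt m' x.1 with h | h
    · exact Or.inl ⟨h1.1, h⟩
    · exact Or.inr ⟨⟨h1.2, h⟩, h2⟩
  refine (Finset.card_le_card hsub).trans ((Finset.card_union_le _ _).trans_eq ?_)
  simp [tailCard]

/-- The step function on blocks of length `L` with value `c k` on the `k`-th block. -/
noncomputable def blockFun {B N : ℕ} (L : ℕ) (c : Fin B → Fin N) (l : ℕ) : ℝ :=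
  if h : l / L < B then ((c ⟨l / L, h⟩ : ℕ) : ℝ) else 0

/-- Take `a` to be the tail count frozen at the start of each block. It drops by at most `q L`
within a block, which bounds `(T - a)²`; being an integer in `[0, n q]`, it has only finitely many
possible values. -/
theorem exists_blockFun_energy_le {n q L B : ℕ} (hB : n ≤ L * B) {S : Finset (ℕ × ℕ)}
    (hS : S ⊆ box n q) :
    ∃ c : Fin B → Fin (n * q + 1), energy n (fun i => fiberCard S i) ≤
      ∑ l ∈ Finset.range n, (2 * blockFun L c l * tailSum n (fun i => fiberCard S i) (l + 1)
        - blockFun L c l ^ 2) + n * (q * L : ℝ) ^ 2 := by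
  refine ⟨fun k => ⟨tailCard S (k * L + 1), Nat.lt_succ_of_le (tailCard_le hS _)⟩, ?_⟩
  rw [energy, ← sub_le_iff_le_add', ← Finset.sum_sub_distrib]
  have hcard : (n : ℝ) * (q * L : ℝ) ^ 2 = ∑ _l ∈ Finset.range n, (q * L : ℝ) ^ 2 := by simp
  rw [hcard]
  refine Finset.sum_le_sum fun l hl => ?_
  have hlB : l / L < B := Nat.div_lt_of_lt_mul ((Finset.mem_range.1 hl).trans_le hB)
  have hL : 0 < L := by
    rcases Nat.eq_zero_or_pos L with rfl | h
    · have := Finset.mem_range.1 hl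
      simp at hB
      omega
    · exact h
  have hle : l / L * L + 1 ≤ l + 1 := Nat.succ_le_succ (Nat.div_mul_le_self l L)
  have hdiff : l + 1 - (l / L * L + 1) ≤ L := by
    have := Nat.div_add_mod' l L
    have := Nat.mod_lt l hL
    omega
  have h1 : (tailCard S (l + 1) : ℝ) ≤ tailCard S (l / L * L + 1) := by
    exact_mod_cast tailCard_anti S hle
  have h2 : (tailCard S (l / L * L + 1) : ℝ) ≤ tailCard S (l + 1) + q * L := by
    have := (tailCard_le_add hS (l / L * L + 1) (l + 1)).trans
      (Nat.add_le_add_left (Nat.mul_le_mul_right q hdiff) _)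
    rw [mul_comm L q] at this
    exact_mod_cast this
  rw [tailSum_fiberCard hS, blockFun, dif_pos hlB]
  have h3 : ((tailCard S (l / L * L + 1) : ℝ) - tailCard S (l + 1)) ^ 2 ≤ (q * L : ℝ) ^ 2 :=
    pow_le_pow_left₀ (sub_nonneg.2 h1) (by linarith) 2
  simp only
  linarith

theorem integral_prod_multiplier_pow_le {Ω : Type*} [MeasurableSpace Ω] {P : Measure Ω}
    {W : ℝ≥0 → Ω → ℝ} (hW : IsPreBrownianReal W P) {ρ : ℝ} (hρ : 0 < ρ) (σ : ℝ) (τ : ℝ≥0)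
    (n q L B : ℕ) (hB : n ≤ L * B) {M : ℝ}
    (hM : ∀ p : ℕ → ℝ, (∀ i, p i ∈ Set.Icc (0 : ℝ) 1) →
      discreteFunctional ρ (σ ^ 2 * τ / 2) q n p ≤ M) :
    ∫ ω, (∏ i ∈ Finset.range n, multiplier W ρ σ τ i ω) ^ q ∂P
      ≤ (n * q + 1 : ℝ) ^ B * Real.exp (M + σ ^ 2 * τ / 2 * (n * (q * L : ℝ) ^ 2)) := by
  have hb : 0 ≤ σ ^ 2 * τ / 2 := by positivity
  rw [integral_prod_multiplier_pow hW hρ]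
  set b := σ ^ 2 * τ / 2
  let lin : (Fin B → Fin (n * q + 1)) → Finset (ℕ × ℕ) → ℝ := fun c S =>
    ∑ i ∈ Finset.range n, fiberCard S i * Real.log ρ + b * ∑ l ∈ Finset.range n,
      (2 * blockFun L c l * tailSum n (fun i => fiberCard S i) (l + 1) - blockFun L c l ^ 2)
  calc _ ≤ ∑ S ∈ (box n q).powerset, ∑ c : Fin B → Fin (n * q + 1),
          Real.exp (lin c S) * Real.exp (b * (n * (q * L : ℝ) ^ 2)) := by
        refine Finset.sum_le_sum fun S hS => ?_
        obtain ⟨c, hc⟩ := exists_blockFun_energy_le hB (Finset.mem_powerset.1 hS)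
        refine le_trans ?_ (Finset.single_le_sum
          (f := fun c => Real.exp (lin c S) * Real.exp (b * (n * (q * L : ℝ) ^ 2)))
          (fun c _ => by positivity) (Finset.mem_univ c))
        simp only [← Real.exp_add, lin]
        refine Real.exp_le_exp.2 ?_
        have h1 := mul_le_mul_of_nonneg_left hc hb
        -- The drift only lowers the exponent, so it is dropped.
        have h2 : 0 ≤ b * ∑ i ∈ Finset.range n, (fiberCard S i : ℝ) * i := by positivity
        linarith
    _ = ∑ c : Fin B → Fin (n * q + 1), (∑ S ∈ (box n q).powerset, Real.exp (lin c S))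
          * Real.exp (b * (n * (q * L : ℝ) ^ 2)) := by
        rw [Finset.sum_comm]
        simp_rw [Finset.sum_mul]
    _ ≤ ∑ c : Fin B → Fin (n * q + 1), Real.exp M * Real.exp (b * (n * (q * L : ℝ) ^ 2)) := by
        refine Finset.sum_le_sum fun c _ => ?_
        exact mul_le_mul_of_nonneg_right (sum_exp_linearized_le hb n q hM _) (Real.exp_pos _).le
    _ = _ := by
        rw [← Real.exp_add, Finset.sum_const, nsmul_eq_mul]
        simp

/-! ### Discretizing admissible functions. -/

theorem entropy_eq_neg_binEntropy (x : ℝ) : entropy x = -Real.binEntropy x := by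
  simp only [entropy, Real.binEntropy, Real.log_inv]
  ring

theorem continuous_entropy : Continuous entropy := by
  rw [funext entropy_eq_neg_binEntropy]
  fun_prop

theorem convexOn_entropy : ConvexOn ℝ (Set.Icc 0 1) entropy := by
  rw [funext entropy_eq_neg_binEntropy]
  exact Real.strictConcave_binEntropy.concaveOn.neg

theorem sum_le_mul_integral_of_antitoneOn {f : ℝ → ℝ} (hf : AntitoneOn f (Set.Icc 0 1)) {n : ℕ}
    (hn : 0 < n) :
    ∑ l ∈ Finset.range n, f ((l + 1 : ℕ) / n) ≤ n * ∫ x in (0 : ℝ)..1, f x ∧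
    n * ∫ x in (0 : ℝ)..1, f x ≤ ∑ l ∈ Finset.range n, f (l / n) := by
  have hn' : (0 : ℝ) < n := by exact_mod_cast hn
  have hanti : AntitoneOn (fun x => f (x / n)) (Set.Icc 0 (0 + (n : ℝ))) := by
    intro x hx y hy hxy
    rw [zero_add] at hx hy
    exact hf ⟨div_nonneg hx.1 hn'.le, (div_le_one hn').2 hx.2⟩
      ⟨div_nonneg hy.1 hn'.le, (div_le_one hn').2 hy.2⟩ (by gcongr)
  have h1 := hanti.sum_le_integral
  have h2 := hanti.integral_le_sum
  rw [intervalIntegral.integral_comp_div f hn'.ne'] at h1 h2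
  simp only [zero_add, zero_div, div_self hn'.ne', smul_eq_mul] at h1 h2
  exact ⟨h1, h2⟩

theorem ae_restrict_Icc_of_admissible {q : ℕ} {g : ℝ → ℝ} (hg : g ∈ admissible q) :
    ∀ᵐ x ∂(volume.restrict (Set.Icc (0 : ℝ) 1)), 0 ≤ deriv g x ∧ deriv g x ≤ q := by
  rw [← Measure.restrict_congr_set Ioo_ae_eq_Icc]
  exact hg.2.2.2

theorem integral_deriv_of_admissible {q : ℕ} {g : ℝ → ℝ} (hg : g ∈ admissible q) {x y : ℝ}
    (hx : 0 ≤ x) (hxy : x ≤ y) (hy : y ≤ 1) :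
    IntervalIntegrable (deriv g) volume x y ∧ ∫ t in x..y, deriv g t = g y - g x := by
  have hac : AbsolutelyContinuousOnInterval g x y := hg.2.2.1.mono <| by
    rw [Set.uIcc_of_le hxy, Set.uIcc_of_le zero_le_one]
    exact Set.Icc_subset_Icc hx hy
  exact ⟨hac.intervalIntegrable_deriv, hac.integral_deriv_eq_sub⟩

theorem sub_bounds_of_admissible {q : ℕ} {g : ℝ → ℝ} (hg : g ∈ admissible q) {x y : ℝ}
    (hx : 0 ≤ x) (hxy : x ≤ y) (hy : y ≤ 1) : 0 ≤ g y - g x ∧ g y - g x ≤ q * (y - x) := by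
  obtain ⟨hint, heq⟩ := integral_deriv_of_admissible hg hx hxy hy
  have hae := ae_restrict_of_ae_restrict_of_subset (Set.Icc_subset_Icc hx hy)
    (ae_restrict_Icc_of_admissible hg)
  rw [← heq]
  constructor
  · exact intervalIntegral.integral_nonneg_of_ae_restrict hxy (hae.mono fun _ h => h.1)
  · calc ∫ t in x..y, deriv g t ≤ ∫ _t in x..y, (q : ℝ) :=
          intervalIntegral.integral_mono_ae_restrict hxy hint intervalIntegrable_const
            (hae.mono fun _ h => h.2)
      _ = q * (y - x) := by simp [mul_comm]

theorem antitoneOn_sq_of_admissible {q : ℕ} {g : ℝ → ℝ} (hg : g ∈ admissible q) :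
    AntitoneOn (fun x => (g 1 - g x) ^ 2) (Set.Icc 0 1) := by
  intro x hx y hy hxy
  have h1 := (sub_bounds_of_admissible hg hy.1 hy.2 le_rfl).1
  have h2 := (sub_bounds_of_admissible hg hx.1 hxy hy.2).1
  exact pow_le_pow_left₀ h1 (by linarith) 2

theorem ae_deriv_div_mem {q : ℕ} {g : ℝ → ℝ} (hg : g ∈ admissible q) :
    ∀ᵐ x ∂(volume.restrict (Set.Icc (0 : ℝ) 1)), deriv g x / q ∈ Set.Icc (0 : ℝ) 1 :=
  (ae_restrict_Icc_of_admissible hg).mono fun _ h =>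
    ⟨div_nonneg h.1 (Nat.cast_nonneg q), div_le_one_of_le₀ h.2 (Nat.cast_nonneg q)⟩

theorem integrableOn_entropy_deriv {q : ℕ} {g : ℝ → ℝ} (hg : g ∈ admissible q) :
    IntegrableOn (fun x => entropy (deriv g x / q)) (Set.Icc 0 1) := by
  obtain ⟨C, hC⟩ := isCompact_Icc.exists_bound_of_continuousOn
    (continuous_entropy.continuousOn (s := Set.Icc (0 : ℝ) 1))
  refine IntegrableOn.of_bound (by simp) ?_ C ((ae_deriv_div_mem hg).mono fun x hx => hC _ hx)
  exact (continuous_entropy.measurable.comp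
    ((measurable_deriv g).div_const _)).aestronglyMeasurable

theorem entropy_slope_le {q : ℕ} {g : ℝ → ℝ} (hg : g ∈ admissible q) {x y : ℝ}
    (hx : 0 ≤ x) (hxy : x < y) (hy : y ≤ 1) :
    entropy ((g y - g x) / (y - x) / q)
      ≤ (y - x)⁻¹ * ∫ t in x..y, entropy (deriv g t / q) := by
  have hsub : Set.Ioc x y ⊆ Set.Icc 0 1 := Set.Ioc_subset_Icc_self.trans (Set.Icc_subset_Icc hx hy)
  obtain ⟨hint, heq⟩ := integral_deriv_of_admissible hg hx hxy.le hy
  have hvol : volume.real (Set.Ioc x y) = y - x := by simp [hxy.le]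
  have h := convexOn_entropy.map_set_average_le (μ := volume) (t := Set.Ioc x y)
    (f := fun t => deriv g t / q) continuous_entropy.continuousOn isClosed_Icc
    (by simp [hxy]) (by simp)
    (ae_restrict_of_ae_restrict_of_subset hsub (ae_deriv_div_mem hg))
    (((intervalIntegrable_iff_integrableOn_Ioc_of_le hxy.le).1 hint).div_const _)
    ((integrableOn_entropy_deriv hg).mono_set hsub)
  rw [setAverage_eq, setAverage_eq, hvol, ← intervalIntegral.integral_of_le hxy.le,
    ← intervalIntegral.integral_of_le hxy.le, intervalIntegral.integral_div, heq, smul_eq_mul,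
    smul_eq_mul] at h
  convert h using 2
  ring

theorem integral_entropy_eq_sum {q : ℕ} {g : ℝ → ℝ} (hg : g ∈ admissible q) {n : ℕ} (hn : 0 < n) :
    ∫ x in (0 : ℝ)..1, entropy (deriv g x / q)
      = ∑ j ∈ Finset.range n, ∫ x in (j / n : ℝ)..((j + 1 : ℕ) / n : ℝ),
          entropy (deriv g x / q) := by
  have hn' : (0 : ℝ) < n := by exact_mod_cast hn
  rw [intervalIntegral.sum_integral_adjacent_intervals (a := fun j : ℕ => (j / n : ℝ))]
  · simp [hn'.ne']
  · intro k hk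
    have hk' : ((k + 1 : ℕ) : ℝ) ≤ n := by exact_mod_cast hk
    have hle : (k / n : ℝ) ≤ (k + 1 : ℕ) / n := by gcongr; simp
    rw [intervalIntegrable_iff_integrableOn_Ioc_of_le hle]
    exact (integrableOn_entropy_deriv hg).mono_set (Set.Ioc_subset_Icc_self.trans
      (Set.Icc_subset_Icc (by positivity) ((div_le_one hn').2 hk')))

theorem tailSum_eq_sub (n : ℕ) (G : ℕ → ℝ) {m : ℕ} (hm : m ≤ n) :
    tailSum n (fun i => G (i + 1) - G i) m = G n - G m := by
  have : tailSum n (fun i => G (i + 1) - G i) m = ∑ i ∈ Finset.Ico m n, (G (i + 1) - G i) := by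
    rw [tailSum, ← Finset.sum_filter]
    congr 1
    ext i
    simp [and_comm]
  rw [this, Finset.sum_Ico_eq_sub _ hm, Finset.sum_range_sub, Finset.sum_range_sub]
  ring

theorem energy_eq_sum_sub (n : ℕ) (G : ℕ → ℝ) :
    energy n (fun i => G (i + 1) - G i) = ∑ l ∈ Finset.range n, (G n - G (l + 1)) ^ 2 :=
  Finset.sum_congr rfl fun l hl => by
    rw [tailSum_eq_sub n G (Nat.succ_le_of_lt (Finset.mem_range.1 hl))]

theorem energy_congr {n : ℕ} {c c' : ℕ → ℝ} (h : ∀ i < n, c i = c' i) :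
    energy n c = energy n c' := by
  refine Finset.sum_congr rfl fun l _ => ?_
  congr 1
  exact Finset.sum_congr rfl fun i hi => by rw [h i (Finset.mem_range.1 hi)]

/-- Tails of increments telescope, and the factors `n / q` in `p` cancel the scaling `q² / n²` of
the energy. -/
theorem discreteFunctional_eq_of_increments {ρ β : ℝ} {q n : ℕ} (hq : 0 < q) (hn : 0 < n)
    (G p : ℕ → ℝ) (hG0 : G 0 = 0) (hp : ∀ i < n, p i = n / q * (G (i + 1) - G i)) :
    discreteFunctional ρ (β / n ^ 2) q n p
      = n * G n * Real.log ρ - q * ∑ i ∈ Finset.range n, entropy (p i)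
        + β * ∑ l ∈ Finset.range n, (G n - G (l + 1)) ^ 2 := by
  have hn' : (n : ℝ) ≠ 0 := by exact_mod_cast hn.ne'
  have hq' : (q : ℝ) ≠ 0 := by exact_mod_cast hq.ne'
  have hsum : ∑ i ∈ Finset.range n, p i = n / q * G n := by
    rw [Finset.sum_congr rfl fun i hi => hp i (Finset.mem_range.1 hi), ← Finset.mul_sum,
      Finset.sum_range_sub, hG0, sub_zero]
  rw [discreteFunctional, energy_congr hp, energy_const_mul, energy_eq_sum_sub,
    Finset.sum_sub_distrib, ← Finset.sum_mul, hsum]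
  field_simp

/-- The profile is the cell average of `g' / q`. Jensen controls the entropy; the remaining error
comes from passing from left to right endpoints. -/
theorem exists_profile_of_admissible {ρ β : ℝ} (hβ : 0 ≤ β) {q n : ℕ} (hq : 0 < q) (hn : 0 < n)
    {g : ℝ → ℝ} (hg : g ∈ admissible q) :
    ∃ p : ℕ → ℝ, (∀ i, p i ∈ Set.Icc (0 : ℝ) 1) ∧
      n * functional ρ β q g ≤ discreteFunctional ρ (β / n ^ 2) q n p + β * q ^ 2 := by
  have hn' : (0 : ℝ) < n := by exact_mod_cast hn
  have hq' : (0 : ℝ) < q := by exact_mod_cast hq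
  let G : ℕ → ℝ := fun i => g (i / n)
  let p : ℕ → ℝ := fun i => if i < n then n / q * (G (i + 1) - G i) else 0
  have hG0 : G 0 = 0 := by simp [G, hg.2.1]
  have hGn : G n = g 1 := by simp [G, hn'.ne']
  have hp : ∀ i < n, p i = n / q * (G (i + 1) - G i) := fun i hi => if_pos hi
  have hlt : ∀ i : ℕ, (i / n : ℝ) < (i + 1 : ℕ) / n := fun i => by gcongr; simp
  have hlen : ∀ i : ℕ, ((i + 1 : ℕ) / n - i / n : ℝ) = 1 / n := fun i => by
    push_cast; ring
  have hle1 : ∀ i < n, ((i + 1 : ℕ) / n : ℝ) ≤ 1 := fun i hi =>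
    (div_le_one hn').2 (by exact_mod_cast hi)
  have h0 : ∀ i : ℕ, (0 : ℝ) ≤ i / n := fun i => by positivity
  have hent : ∑ i ∈ Finset.range n, entropy (p i)
      ≤ n * ∫ x in (0 : ℝ)..1, entropy (deriv g x / q) := by
    rw [integral_entropy_eq_sum hg hn, Finset.mul_sum]
    refine Finset.sum_le_sum fun i hi => ?_
    have hi' := Finset.mem_range.1 hi
    have h := entropy_slope_le hg (h0 i) (hlt i) (hle1 i hi')
    rw [hlen, one_div, inv_inv] at h
    refine le_of_eq_of_le ?_ h
    rw [hp i hi']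
    congr 1
    simp only [G, div_inv_eq_mul]
    ring
  refine ⟨p, fun i => ?_, ?_⟩
  · by_cases hi : i < n
    · rw [hp i hi]
      obtain ⟨h1, h2⟩ := sub_bounds_of_admissible hg (h0 i) (hlt i).le (hle1 i hi)
      rw [hlen] at h2
      refine ⟨mul_nonneg (by positivity) h1, ?_⟩
      calc n / q * (G (i + 1) - G i) ≤ n / q * (q * (1 / n)) := by gcongr
        _ = 1 := by field_simp
    · simp [p, hi]
  · rw [discreteFunctional_eq_of_increments hq hn G p hG0 hp, hGn, functional]
    -- The left Riemann sum dominates the integral. It exceeds the right one by `g(1)² ≤ q²`.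
    have hR := (sum_le_mul_integral_of_antitoneOn (antitoneOn_sq_of_admissible hg) hn).2
    have hshift : ∑ l ∈ Finset.range n, (g 1 - g (l / n)) ^ 2
        ≤ ∑ l ∈ Finset.range n, (g 1 - G (l + 1)) ^ 2 + q ^ 2 := by
      have h := Finset.sum_range_sub (fun l : ℕ => (g 1 - G l) ^ 2) n
      rw [Finset.sum_sub_distrib, hGn, hG0] at h
      have h1 := hg.1 (Set.right_mem_Icc.2 zero_le_one)
      have h2 : g 1 ^ 2 ≤ (q : ℝ) ^ 2 := pow_le_pow_left₀ h1.1 h1.2 2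
      simp only [sub_self, sub_zero] at h
      simp only [G] at h ⊢
      linarith
    have hβR := mul_le_mul_of_nonneg_left (hR.trans hshift) hβ
    have hqent := mul_le_mul_of_nonneg_left hent hq'.le
    linarith

/-! ### Polygons: from profiles to admissible functions. -/

/-- The piecewise linear function vanishing at `0` with slope `s i` on `[i/n, (i+1)/n]`. -/
noncomputable def polygon (n : ℕ) (s : ℕ → ℝ) (x : ℝ) : ℝ :=
  ∑ i ∈ Finset.range n, s i / n * max 0 (min 1 (n * x - i))

theorem polygon_node {n : ℕ} (hn : 0 < n) (s : ℕ → ℝ) {l : ℕ} (hl : l ≤ n) :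
    polygon n s (l / n) = ∑ i ∈ Finset.range l, s i / n := by
  have hn' : (n : ℝ) ≠ 0 := by exact_mod_cast hn.ne'
  have hsub : Finset.range l ⊆ Finset.range n := Finset.range_subset_range.2 hl
  rw [polygon, ← Finset.sum_subset hsub (f := fun i : ℕ => s i / n * max 0 (min 1 ((n : ℝ) * (l / n) - i)))]
  · refine Finset.sum_congr rfl fun i hi => ?_
    have : (i : ℝ) + 1 ≤ l := by exact_mod_cast Finset.mem_range.1 hi
    rw [mul_div_cancel₀ _ hn', min_eq_left (by linarith), max_eq_right zero_le_one, mul_one]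
  · intro i _ hi
    have : (l : ℝ) ≤ i := by exact_mod_cast not_lt.1 (mt Finset.mem_range.2 hi)
    rw [mul_div_cancel₀ _ hn', max_eq_left ((min_le_right _ _).trans (by linarith)), mul_zero]

theorem hasDerivAt_ramp {n : ℕ} (hn : 0 < n) (i j : ℕ) {x : ℝ}
    (hx : x ∈ Set.Ioo (j / n : ℝ) ((j + 1 : ℕ) / n)) :
    HasDerivAt (fun x : ℝ => max 0 (min 1 (n * x - i))) (if i = j then (n : ℝ) else 0) x := by
  have hn' : (0 : ℝ) < n := by exact_mod_cast hn
  have hmem := Ioo_mem_nhds hx.1 hx.2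
  have hb : ∀ y ∈ Set.Ioo (j / n : ℝ) ((j + 1 : ℕ) / n), (j : ℝ) < n * y ∧ n * y < j + 1 := by
    intro y hy
    have h1 := (div_lt_iff₀' hn').1 hy.1
    have h2 := (lt_div_iff₀' hn').1 hy.2
    push_cast at h2
    exact ⟨h1, h2⟩
  rcases lt_trichotomy i j with h | rfl | h
  · rw [if_neg h.ne]
    refine (hasDerivAt_const x (1 : ℝ)).congr_of_eventuallyEq (eventually_of_mem hmem ?_)
    intro y hy
    have : (i : ℝ) + 1 ≤ j := by exact_mod_cast h
    simp only
    rw [min_eq_left (by linarith [(hb y hy).1]), max_eq_right zero_le_one]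
  · rw [if_pos rfl]
    have hlin : HasDerivAt (fun y : ℝ => n * y - i) (n : ℝ) x := by
      simpa using ((hasDerivAt_id x).const_mul (n : ℝ)).sub_const (i : ℝ)
    refine hlin.congr_of_eventuallyEq (eventually_of_mem hmem ?_)
    intro y hy
    simp only
    rw [min_eq_right (by linarith [(hb y hy).2]), max_eq_right (by linarith [(hb y hy).1])]
  · rw [if_neg h.ne']
    refine (hasDerivAt_const x (0 : ℝ)).congr_of_eventuallyEq (eventually_of_mem hmem ?_)
    intro y hy
    have : (j : ℝ) + 1 ≤ i := by exact_mod_cast h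
    simp only
    rw [max_eq_left ((min_le_right _ _).trans (by linarith [(hb y hy).2]))]

theorem deriv_polygon {n : ℕ} (hn : 0 < n) (s : ℕ → ℝ) {j : ℕ} (hj : j < n) {x : ℝ}
    (hx : x ∈ Set.Ioo (j / n : ℝ) ((j + 1 : ℕ) / n)) : deriv (polygon n s) x = s j := by
  have hn' : (n : ℝ) ≠ 0 := by exact_mod_cast hn.ne'
  have h : HasDerivAt (polygon n s)
      (∑ i ∈ Finset.range n, s i / n * if i = j then (n : ℝ) else 0) x :=
    HasDerivAt.fun_sum fun i _ => (hasDerivAt_ramp hn i j hx).const_mul _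
  rw [h.deriv]
  simp [hj, hn']

theorem absolutelyContinuousOnInterval_polygon (n : ℕ) (s : ℕ → ℝ) (a b : ℝ) :
    AbsolutelyContinuousOnInterval (polygon n s) a b := by
  have hterm : ∀ i : ℕ, AbsolutelyContinuousOnInterval
      (fun x : ℝ => s i / n * max 0 (min 1 (n * x - i))) a b := by
    intro i
    have hl : LipschitzWith n (fun x : ℝ => n * x - i) := LipschitzWith.of_dist_le_mul fun x y => by
      simp [Real.dist_eq, ← mul_sub, abs_mul]
    exact (((hl.const_min 1).const_max 0).lipschitzOnWith.absolutelyContinuousOnInterval).const_mul _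
  have : ∀ k : ℕ, AbsolutelyContinuousOnInterval
      (fun x : ℝ => ∑ i ∈ Finset.range k, s i / n * max 0 (min 1 (n * x - i))) a b := by
    intro k
    induction k with
    | zero => simpa using (LipschitzWith.const (0 : ℝ)).lipschitzOnWith.absolutelyContinuousOnInterval
    | succ k ih => simpa only [Finset.sum_range_succ] using ih.fun_add (hterm k)
  exact this n

theorem polygon_mem_admissible {n q : ℕ} (hn : 0 < n) {s : ℕ → ℝ}
    (hs : ∀ i, s i ∈ Set.Icc (0 : ℝ) q) : polygon n s ∈ admissible q := by
  have hn' : (0 : ℝ) < n := by exact_mod_cast hn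
  refine ⟨fun x _ => ⟨?_, ?_⟩, ?_, absolutelyContinuousOnInterval_polygon n s 0 1, ?_⟩
  · exact Finset.sum_nonneg fun i _ =>
      mul_nonneg (div_nonneg (hs i).1 hn'.le) (le_max_left _ _)
  · calc polygon n s x ≤ ∑ _i ∈ Finset.range n, (q : ℝ) / n := by
          refine Finset.sum_le_sum fun i _ => ?_
          have h1 : s i / n ≤ q / n := div_le_div_of_nonneg_right (hs i).2 hn'.le
          exact (mul_le_of_le_one_right (div_nonneg (hs i).1 hn'.le)
            (max_le zero_le_one (min_le_left _ _))).trans h1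
      _ = q := by simp [mul_div_cancel₀ _ hn'.ne']
  · simpa using polygon_node hn s (Nat.zero_le n)
  -- The nodes, where the slope may jump, form a countable null set.
  · have hc : ∀ᵐ x : ℝ, x ∉ Set.range fun k : ℕ => (k / n : ℝ) :=
      (Set.countable_range _).ae_notMem _
    filter_upwards [ae_restrict_of_ae hc, ae_restrict_mem measurableSet_Ioo] with x hx hx01
    have hnx : 0 ≤ n * x := mul_nonneg hn'.le hx01.1.le
    have hfl := Nat.floor_le hnx
    have hlf := Nat.lt_floor_add_one (n * x)
    have hne : (⌊n * x⌋₊ : ℝ) ≠ n * x := fun h =>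
      hx ⟨⌊n * x⌋₊, by simp only [h]; field_simp⟩
    have hj : ⌊n * x⌋₊ < n := by
      rw [Nat.floor_lt hnx]
      exact mul_lt_of_lt_one_right hn' hx01.2
    rw [deriv_polygon hn s hj ⟨(div_lt_iff₀' hn').2 (lt_of_le_of_ne hfl hne),
      (lt_div_iff₀' hn').2 (by exact_mod_cast hlf)⟩]
    exact hs _

/-- On the polygon with slopes `q p_i` the entropy integral is exact, and the energy is a right
Riemann sum of a decreasing function, hence at most the integral; no error term arises. -/
theorem exists_admissible_of_profile {ρ β : ℝ} (hβ : 0 ≤ β) {q n : ℕ} (hq : 0 < q) (hn : 0 < n)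
    {p : ℕ → ℝ} (hp : ∀ i, p i ∈ Set.Icc (0 : ℝ) 1) :
    ∃ g ∈ admissible q, discreteFunctional ρ (β / n ^ 2) q n p ≤ n * functional ρ β q g := by
  have hn' : (0 : ℝ) < n := by exact_mod_cast hn
  have hq' : (0 : ℝ) < q := by exact_mod_cast hq
  let s : ℕ → ℝ := fun i => q * p i
  have hg : polygon n s ∈ admissible q := polygon_mem_admissible hn fun i =>
    ⟨mul_nonneg hq'.le (hp i).1, mul_le_of_le_one_right hq'.le (hp i).2⟩
  refine ⟨polygon n s, hg, ?_⟩
  let G : ℕ → ℝ := fun l => ∑ i ∈ Finset.range l, s i / n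
  have hG : ∀ l ≤ n, polygon n s (l / n) = G l := fun l hl => polygon_node hn s hl
  have hGn : polygon n s 1 = G n := by rw [← hG n le_rfl, div_self hn'.ne']
  have hpG : ∀ i < n, p i = n / q * (G (i + 1) - G i) := by
    intro i _
    simp only [G, s, Finset.sum_range_succ, add_sub_cancel_left]
    field_simp
  have hent : n * ∫ x in (0 : ℝ)..1, entropy (deriv (polygon n s) x / q)
      = ∑ i ∈ Finset.range n, entropy (p i) := by
    rw [integral_entropy_eq_sum hg hn, Finset.mul_sum]
    refine Finset.sum_congr rfl fun j hj => ?_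
    have hle : (j / n : ℝ) ≤ (j + 1 : ℕ) / n := by gcongr; simp
    rw [intervalIntegral.integral_congr_Ioo_of_le hle (g := fun _ => entropy (p j))]
    · rw [intervalIntegral.integral_const, smul_eq_mul]
      push_cast
      field_simp
      ring
    · intro x hx
      simp only [deriv_polygon hn s (Finset.mem_range.1 hj) hx, s, mul_div_cancel_left₀ _ hq'.ne']
  have hR := (sum_le_mul_integral_of_antitoneOn (antitoneOn_sq_of_admissible hg) hn).1
  have hR' : ∑ l ∈ Finset.range n, (G n - G (l + 1)) ^ 2
      = ∑ l ∈ Finset.range n, (polygon n s 1 - polygon n s ((l + 1 : ℕ) / n)) ^ 2 :=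
    Finset.sum_congr rfl fun l hl => by
      rw [hGn, hG (l + 1) (Nat.succ_le_of_lt (Finset.mem_range.1 hl))]
  rw [discreteFunctional_eq_of_increments hq hn G p (by simp [G]) hpG, hR', functional, ← hent,
    ← hGn]
  have := mul_le_mul_of_nonneg_left hR hβ
  linarith

/-! ### The supremum and its scaling in `q`. -/

theorem admissible_nonempty (q : ℕ) : (admissible q).Nonempty :=
  ⟨polygon 1 fun _ => 0, polygon_mem_admissible one_pos fun _ => ⟨le_rfl, Nat.cast_nonneg q⟩⟩

theorem bddAbove_functional {ρ β : ℝ} (hρ : 0 < ρ) (hβ : 0 ≤ β) {q : ℕ} (hq : 0 < q) :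
    BddAbove (functional ρ β q '' admissible q) := by
  refine ⟨q * Real.log (1 + ρ) + β * q ^ 2, ?_⟩
  rintro _ ⟨g, hg, rfl⟩
  -- A single cell suffices: for `n = 1` the energy vanishes, and Gibbs' inequality bounds the rest
  -- by `log (1 + ρ)`.
  obtain ⟨p, hp, h⟩ := exists_profile_of_admissible (ρ := ρ) hβ hq one_pos hg
  have h1 : p 0 * Real.log ρ - entropy (p 0) ≤ Real.log (1 + ρ) := by
    rw [Real.le_log_iff_exp_le (by positivity)]
    simpa [Real.exp_log hρ] using exp_mul_sub_entropy_le (hp 0) (Real.log ρ)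
  have h2 := mul_le_mul_of_nonneg_left h1 (Nat.cast_nonneg (α := ℝ) q)
  simp only [discreteFunctional, energy, tailSum, Finset.sum_range_one, Nat.cast_one, one_mul,
    zero_add, nonpos_iff_eq_zero, one_ne_zero, if_false] at h
  linarith

theorem isLUB_functional {ρ β : ℝ} (hρ : 0 < ρ) (hβ : 0 ≤ β) {q : ℕ} (hq : 0 < q) :
    IsLUB (functional ρ β q '' admissible q) (sSup (functional ρ β q '' admissible q)) :=
  isLUB_csSup ((admissible_nonempty q).image _) (bddAbove_functional hρ hβ hq)

theorem const_mul_mem_admissible {q r : ℕ} {c : ℝ} (hc : 0 ≤ c) (hcr : c * q = r) {g : ℝ → ℝ}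
    (hg : g ∈ admissible q) : (fun x => c * g x) ∈ admissible r := by
  refine ⟨fun x hx => ⟨mul_nonneg hc (hg.1 hx).1, ?_⟩, by simp [hg.2.1], hg.2.2.1.const_mul c, ?_⟩
  · exact hcr ▸ mul_le_mul_of_nonneg_left (hg.1 hx).2 hc
  · filter_upwards [hg.2.2.2] with x hx
    rw [deriv_const_mul_field]
    exact ⟨mul_nonneg hc hx.1, hcr ▸ mul_le_mul_of_nonneg_left hx.2 hc⟩

theorem functional_mul (ρ β : ℝ) {q : ℕ} (hq : 0 < q) (g : ℝ → ℝ) :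
    functional ρ β q (fun x => q * g x) = q * functional ρ (q * β) 1 g := by
  have hq' : (q : ℝ) ≠ 0 := by exact_mod_cast hq.ne'
  simp only [functional, deriv_const_mul_field, mul_div_cancel_left₀ _ hq', Nat.cast_one, div_one,
    ← mul_sub, mul_pow, intervalIntegral.integral_const_mul]
  ring

theorem sSup_functional_eq (ρ β : ℝ) {q : ℕ} (hq : 0 < q) :
    sSup (functional ρ β q '' admissible q)
      = q * sSup (functional ρ (q * β) 1 '' admissible 1) := by
  have hq' : (0 : ℝ) < q := by exact_mod_cast hq
  have himage : functional ρ β q '' admissible q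
      = (fun y => (q : ℝ) * y) '' (functional ρ (q * β) 1 '' admissible 1) := by
    ext y
    constructor
    · rintro ⟨g, hg, rfl⟩
      refine ⟨_, ⟨fun x => (q : ℝ)⁻¹ * g x, const_mul_mem_admissible (inv_nonneg.2 hq'.le)
        (by simp [hq'.ne']) hg, rfl⟩, ?_⟩
      simp only [← functional_mul ρ β hq, mul_inv_cancel_left₀ hq'.ne']
    · rintro ⟨_, ⟨g, hg, rfl⟩, rfl⟩
      exact ⟨_, const_mul_mem_admissible hq'.le (by simp) hg, functional_mul ρ β hq g⟩
  rw [himage]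
  exact Real.sSup_smul_of_nonneg hq'.le _

/-! ### Asymptotics of the moments. -/

theorem integral_process_pow {Ω : Type*} [MeasurableSpace Ω] (P : Measure Ω)
    (W : ℝ≥0 → Ω → ℝ) (x₀ ρ σ : ℝ) (τ : ℝ≥0) (n q : ℕ) :
    ∫ ω, process W x₀ ρ σ τ n ω ^ q ∂P
      = x₀ ^ q * ∫ ω, (∏ i ∈ Finset.range n, multiplier W ρ σ τ i ω) ^ q ∂P := by
  simp_rw [process_eq_prod, mul_pow, integral_const_mul]

theorem integrable_process_pow {Ω : Type*} [MeasurableSpace Ω] {P : Measure Ω}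
    {W : ℝ≥0 → Ω → ℝ} (hW : IsPreBrownianReal W P) (x₀ : ℝ) {ρ : ℝ} (hρ : 0 < ρ) (σ : ℝ)
    (τ : ℝ≥0) (n q : ℕ) :
    Integrable (fun ω => process W x₀ ρ σ τ n ω ^ q) P := by
  simp_rw [process_eq_prod, mul_pow]
  exact (integrable_prod_multiplier_pow hW hρ σ τ n q).const_mul _

theorem log_moment_bounds {Ω : Type*} [MeasurableSpace Ω] {P : Measure Ω}
    {W : ℝ≥0 → Ω → ℝ} (hW : IsPreBrownianReal W P) {x₀ ρ β σ : ℝ} {τ : ℝ≥0} (hx₀ : 0 < x₀)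
    (hρ : 0 < ρ) (hβ : 0 ≤ β) {n q : ℕ} (hn : 0 < n) (hq : 0 < q)
    (h : σ ^ 2 * (τ : ℝ) * (n : ℝ) ^ 2 / 2 = β) :
    n * sSup (functional ρ β q '' admissible q) + (q * Real.log x₀ - β * q ^ 2 - β * q)
      ≤ Real.log (∫ ω, process W x₀ ρ σ τ n ω ^ q ∂P) ∧
    Real.log (∫ ω, process W x₀ ρ σ τ n ω ^ q ∂P)
      ≤ n * sSup (functional ρ β q '' admissible q) + (q * Real.log x₀ + 4 * β * q ^ 2)
        + 2 * √n * Real.log (n * q + 1) := by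
  have hn' : (0 : ℝ) < n := by exact_mod_cast hn
  have hb : σ ^ 2 * τ / 2 = β / n ^ 2 := by
    rw [← h]
    field_simp
  have hLUB := isLUB_functional hρ hβ hq
  have hlow := fun p hp => exp_discreteFunctional_le_integral (p := p) hW hρ σ τ n q hp
  have hpos : 0 < ∫ ω, (∏ i ∈ Finset.range n, multiplier W ρ σ τ i ω) ^ q ∂P :=
    (Real.exp_pos _).trans_le (hlow (fun _ => 0) fun _ => by simp)
  rw [integral_process_pow, Real.log_mul (pow_pos hx₀ q).ne' hpos.ne', Real.log_pow]
  constructor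
  · have hsup : sSup (functional ρ β q '' admissible q)
        ≤ (Real.log (∫ ω, (∏ i ∈ Finset.range n, multiplier W ρ σ τ i ω) ^ q ∂P)
          + β * q ^ 2 + β * q) / n := by
      refine hLUB.2 ?_
      rintro _ ⟨g, hg, rfl⟩
      obtain ⟨p, hp, hgp⟩ := exists_profile_of_admissible (ρ := ρ) hβ hq hn hg
      have h1 := (Real.le_log_iff_exp_le hpos).2 (hlow p hp)
      have h2 : β / n ^ 2 * (q * n ^ 2) = β * q := by field_simp
      rw [hb, h2] at h1
      rw [le_div_iff₀' hn']
      linarith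
    rw [le_div_iff₀' hn'] at hsup
    linarith
  -- Block length and block number are both `√n + 1` (integer root). This keeps the linearization
  -- error bounded and the number of block functions subexponential.
  · have hsqrt : n ≤ (n.sqrt + 1) * (n.sqrt + 1) := (Nat.lt_succ_sqrt n).le
    have hup := integral_prod_multiplier_pow_le hW hρ σ τ n q (n.sqrt + 1) (n.sqrt + 1) hsqrt
      (M := n * sSup (functional ρ β q '' admissible q)) fun p hp => by
        obtain ⟨g, hg, hpg⟩ := exists_admissible_of_profile (ρ := ρ) hβ hq hn hp
        rw [hb]
        exact hpg.trans (mul_le_mul_of_nonneg_left (hLUB.1 ⟨g, hg, rfl⟩) hn'.le)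
    have hL : ((n.sqrt + 1 : ℕ) : ℝ) ≤ 2 * √n := by
      have h1 := Real.nat_sqrt_le_real_sqrt (a := n)
      have h2 : 1 ≤ √(n : ℝ) := Real.one_le_sqrt.2 (by exact_mod_cast hn)
      push_cast
      linarith
    have hlog := Real.log_le_log hpos hup
    rw [Real.log_mul (by positivity) (Real.exp_pos _).ne', Real.log_exp, Real.log_pow, hb] at hlog
    have hsq : β / n ^ 2 * (n * (q * (n.sqrt + 1 : ℕ)) ^ 2) ≤ 4 * β * q ^ 2 := by
      calc β / n ^ 2 * (n * (q * (n.sqrt + 1 : ℕ)) ^ 2)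
          ≤ β / n ^ 2 * (n * (q * (2 * √n)) ^ 2) := by gcongr
        _ = 4 * β * q ^ 2 := by
          rw [mul_pow, mul_pow, Real.sq_sqrt hn'.le]
          field_simp
          ring
    have hlog0 : 0 ≤ Real.log (n * q + 1) := Real.log_nonneg (by
      have : (0 : ℝ) ≤ n * q := by positivity
      linarith)
    have := mul_le_mul_of_nonneg_right hL hlog0
    linarith

theorem tendsto_sqrt_mul_log_div (q : ℕ) :
    Tendsto (fun n : ℕ => 2 * √(n : ℝ) * Real.log (n * q + 1) / n) atTop (𝓝 0) := by
  have hlim : Tendsto (fun n : ℕ => 8 * (q + 1 : ℝ) ^ (1 / 4 : ℝ) * (n : ℝ) ^ (-(1 / 4) : ℝ))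
      atTop (𝓝 0) := by
    simpa using ((tendsto_rpow_neg_atTop (by norm_num : (0 : ℝ) < 1 / 4)).comp
      tendsto_natCast_atTop_atTop).const_mul (8 * (q + 1 : ℝ) ^ (1 / 4 : ℝ))
  refine squeeze_zero' (Eventually.of_forall fun n => ?_) ?_ hlim
  · have : 0 ≤ Real.log (n * q + 1) := Real.log_nonneg (by
      have : (0 : ℝ) ≤ n * q := by positivity
      linarith)
    positivity
  · filter_upwards [eventually_ge_atTop 1] with n hn
    have hn1 : (1 : ℝ) ≤ n := by exact_mod_cast hn
    have hn' : (0 : ℝ) < n := by linarith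
    -- Any exponent below `1/2` would do here; `1/4` leaves `n ^ (-1/4)`.
    have hlog : Real.log (n * q + 1) ≤ 4 * ((q + 1 : ℝ) ^ (1 / 4 : ℝ) * (n : ℝ) ^ (1 / 4 : ℝ)) := by
      rw [← Real.mul_rpow (by positivity) hn'.le]
      have h1 : (n * q + 1 : ℝ) ≤ (q + 1) * n := by linarith
      have h2 := Real.log_le_rpow_div (x := (q + 1 : ℝ) * n) (by positivity)
        (by norm_num : (0 : ℝ) < 1 / 4)
      linarith [Real.log_le_log (by positivity) h1]
    have hpow : √(n : ℝ) * (n : ℝ) ^ (1 / 4 : ℝ) / n = (n : ℝ) ^ (-(1 / 4) : ℝ) := by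
      rw [Real.sqrt_eq_rpow, ← Real.rpow_add hn', ← Real.rpow_sub_one hn'.ne']
      norm_num
    calc 2 * √(n : ℝ) * Real.log (n * q + 1) / n
        ≤ 2 * √(n : ℝ) * (4 * ((q + 1 : ℝ) ^ (1 / 4 : ℝ) * (n : ℝ) ^ (1 / 4 : ℝ))) / n := by gcongr
      _ = 8 * (q + 1 : ℝ) ^ (1 / 4 : ℝ) * (√(n : ℝ) * (n : ℝ) ^ (1 / 4 : ℝ) / n) := by ring
      _ = _ := by rw [hpow]

theorem tendsto_log_moment {Ω : Type*} [MeasurableSpace Ω] {P : Measure Ω}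
    {W : ℝ≥0 → Ω → ℝ} (hW : IsPreBrownianReal W P) {x₀ ρ β : ℝ} {σ : ℕ → ℝ} {τ : ℕ → ℝ≥0}
    (hx₀ : 0 < x₀) (hρ : 0 < ρ) (hβ : 0 ≤ β) {q : ℕ} (hq : 0 < q)
    (h : ∀ n : ℕ, 1 ≤ n → σ n ^ 2 * (τ n : ℝ) * (n : ℝ) ^ 2 / 2 = β) :
    Tendsto (fun n : ℕ => (1 / (n : ℝ)) *
        Real.log (∫ ω, process W x₀ ρ (σ n) (τ n) n ω ^ q ∂P))
      atTop (𝓝 (sSup (functional ρ β q '' admissible q))) := by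
  set Λ := sSup (functional ρ β q '' admissible q)
  have hlow : Tendsto (fun n : ℕ => Λ + (q * Real.log x₀ - β * q ^ 2 - β * q) / n) atTop (𝓝 Λ) := by
    simpa using (tendsto_const_div_atTop_nhds_zero_nat
      (q * Real.log x₀ - β * q ^ 2 - β * q)).const_add Λ
  have hup : Tendsto (fun n : ℕ => Λ + (q * Real.log x₀ + 4 * β * q ^ 2) / n
      + 2 * √(n : ℝ) * Real.log (n * q + 1) / n) atTop (𝓝 Λ) := by
    simpa using ((tendsto_const_div_atTop_nhds_zero_nat
      (q * Real.log x₀ + 4 * β * q ^ 2)).const_add Λ).add (tendsto_sqrt_mul_log_div q)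
  refine tendsto_of_tendsto_of_tendsto_of_le_of_le' hlow hup ?_ ?_ <;>
    filter_upwards [eventually_ge_atTop 1] with n hn <;>
    have hn' : (0 : ℝ) < n := by exact_mod_cast hn
  · have hb := (log_moment_bounds hW hx₀ hρ hβ hn hq (h n hn)).1
    rw [one_div_mul_eq_div, le_div_iff₀' hn', mul_add, mul_div_cancel₀ _ hn'.ne']
    exact hb
  · have hb := (log_moment_bounds hW hx₀ hρ hβ hn hq (h n hn)).2
    rw [one_div_mul_eq_div, div_le_iff₀' hn', mul_add, mul_add, mul_div_cancel₀ _ hn'.ne',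
      mul_div_cancel₀ _ hn'.ne']
    exact hb

end LyapunovRMP

theorem mainTheorem2 {Ω : Type*} [MeasurableSpace Ω] (P : Measure Ω) [IsProbabilityMeasure P]
    (W : ℝ≥0 → Ω → ℝ) (hW : IsBrownianReal W P) :
    ∃ lam : ℝ → ℝ → ℕ → ℝ, ∀ ρ β : ℝ, 0 < ρ → 0 < β → ∀ q : ℕ, 1 ≤ q →
      (∀ (x₀ : ℝ) (σ : ℕ → ℝ) (τ : ℕ → ℝ≥0), 0 < x₀ →
        (∀ n : ℕ, 1 ≤ n →
          0 < σ n ∧ 0 < τ n ∧ σ n ^ 2 * (τ n : ℝ) * (n : ℝ) ^ 2 / 2 = β) →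
        (∀ n : ℕ, Integrable
          (fun ω => LyapunovRMP.process W x₀ ρ (σ n) (τ n) n ω ^ q) P) ∧
        Tendsto (fun n : ℕ => (1 / (n : ℝ)) *
            Real.log (∫ ω, LyapunovRMP.process W x₀ ρ (σ n) (τ n) n ω ^ q ∂P))
          atTop (𝓝 (lam ρ β q))) ∧
      IsLUB (LyapunovRMP.functional ρ β q '' LyapunovRMP.admissible q) (lam ρ β q) ∧
      lam ρ β q = q * lam ρ (q * β) 1 := by
  -- The witness mentions none of `W`, `x₀`, `σ`, `τ`, so the limit's independence of them is built
  -- in.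
  refine ⟨fun ρ β q => sSup (LyapunovRMP.functional ρ β q '' LyapunovRMP.admissible q),
    fun ρ β hρ hβ q hq => ⟨fun x₀ σ τ hx₀ h => ⟨fun n => ?_, ?_⟩, ?_, ?_⟩⟩
  · exact LyapunovRMP.integrable_process_pow hW.toIsPreBrownianReal x₀ hρ (σ n) (τ n) n q
  · exact LyapunovRMP.tendsto_log_moment hW.toIsPreBrownianReal hx₀ hρ hβ.le hq
      fun n hn => (h n hn).2.2
  · exact LyapunovRMP.isLUB_functional hρ hβ.le hq
  · exact LyapunovRMP.sSup_functional_eq ρ β hq
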